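/- Let $\Gamma$ be the star graph consisting of $N\ge 2$ half-lines $[0,\infty)$ (the edges) glued at their origins (the vertex). A function on $\Gamma$ is a family $u=(u_e)_{e=1}^N$ of functions $u_e:[0,\infty)\to\mathbb C$. Let $H^1(\Gamma)$ be the space of continuous functions on $\Gamma$ (so $u_e(0)=u_r(0)$ for all $e,r$) with $u_e\in H^1(\mathbb R^+)$ for each $e$, and let $$W(\Gamma)=\bigl\{u\in H^1(\Gamma):\ |u_e|^2\,\mathrm{Log}|u_e|^2\in L^1(\mathbb R^+),\ e=1,\dots,N\bigr\}.$$ Let $\gamma>0$ and $\omega\in\mathbb R$. A solution of the stationary problem $$-\Delta_\gamma\varphi+\omega\varphi-\varphi\,\mathrm{Log}|\varphi|^2=0\quad\text{in } W'(\Gamma)$$ is a function $\varphi\in W(\Gamma)$ such that for all $v\in W(\Gamma)$ $$\sum_{e=1}^N\int_0^\infty \varphi_e'\,\overline{v_e'}\,dx-\gamma\,\varphi_1(0)\overline{v_1(0)}+\omega\sum_{e=1}^N\int_0^\infty\varphi_e\,\overline{v_e}\,dx-\sum_{e=1}^N\int_0^\infty \varphi_e\,\mathrm{Log}|\varphi_e|^2\;\overline{v_e}\,dx=0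 .$$ It is called positive if it is real-valued and strictly positive at every point of $\Gamma$. Theorem. Let $N\ge2$, $\gamma>0$ and $\omega\in\mathbb R$. Then a function on $\Gamma$ is a positive solution of the stationary problem if and only if, up to a permutation of the edges, it is one of the functions $\phi^\kappa_{\omega,\gamma}$, $\kappa=0,1,\dots,[(N-1)/2]$, given by $$(\phi^\kappa_{\omega,\gamma})_i(x)=\begin{cases}e^{\frac{\omega+1}{2}}e^{-\frac12(x-h_\kappa)^2}, & i=1,\dots,\kappa,\\ e^{\frac{\omega+1}{2}}e^{-\frac12(x+h_\kappa)^2}, & i=\kappa+1,\dots,N,\end{cases}\qquad h_\kappa=\frac{\gamma}{N-2\kappa},$$ where $[s]$ is the integer part of $s$. Moreover, for different values of $\kappa$ these functions are not permutations of each other, so up to permutation of the edges there are exactly $[(N-1)/2]+1$ positive solutions. -/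

import Mathlib

open MeasureTheory Set
open scoped ComplexConjugate

/-! ### Function spaces on a star graph

The star graph `Γ` with `N` edges is the union of `N` copies of the half-line `[0, ∞)`, glued at
their origins (the central vertex). A complex function on `Γ` is a family
`u : Fin N → ℝ → ℂ`, of which only the values `u e x` with `0 ≤ x` matter. -/

namespace StarGraph

noncomputable section

/-- `g` is the weak (distributional) derivative of `f` on `(0, ∞)`: integration by parts holds
against every smooth test function with compact support inside `(0, ∞)`. -/
def IsWeakDeriv (f g : ℝ → ℂ) : Prop :=
  ∀ ξ : ℝ → ℝ, ContDiff ℝ (⊤ : ℕ∞) ξ → HasCompactSupport ξ → tsupport ξ ⊆ Ioi 0 →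
    ∫ x in Ioi (0 : ℝ), deriv ξ x • f x = -∫ x in Ioi (0 : ℝ), ξ x • g x

/-- `L²(ℝ⁺)`. -/
def MemL2 (f : ℝ → ℂ) : Prop := MemLp f 2 (volume.restrict (Ioi (0 : ℝ)))

/-- `H¹(ℝ⁺)`: square integrable functions with a square integrable weak derivative. -/
def MemH1 (f : ℝ → ℂ) : Prop := MemL2 f ∧ ∃ g : ℝ → ℂ, MemL2 g ∧ IsWeakDeriv f g

open Classical in
/-- The weak derivative `∂ₓ f ∈ L²(ℝ⁺)` of `f ∈ H¹(ℝ⁺)`, which is unique almost everywhere. -/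
def weakDeriv (f : ℝ → ℂ) : ℝ → ℂ :=
  if h : ∃ g : ℝ → ℂ, MemL2 g ∧ IsWeakDeriv f g then h.choose else 0

/-- `H¹(Γ)`: functions that are continuous on the graph (on each closed edge, with a common value
at the vertex) and lie in `H¹(ℝ⁺)` on each edge. -/
structure MemH1Graph {N : ℕ} (u : Fin N → ℝ → ℂ) : Prop where
  memH1 : ∀ e, MemH1 (u e)
  continuousOn : ∀ e, ContinuousOn (u e) (Ici 0)
  vertex : ∀ e r, u e 0 = u r 0

/-- The energy space `W(Γ)`: functions `u ∈ H¹(Γ)` such that `|uₑ|² Log |uₑ|² ∈ L¹(ℝ⁺)` on each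
edge. -/
structure MemW {N : ℕ} (u : Fin N → ℝ → ℂ) : Prop extends MemH1Graph u where
  integrable_log : ∀ e, IntegrableOn (fun x => ‖u e x‖ ^ 2 * Real.log (‖u e x‖ ^ 2)) (Ioi 0)

/-- The value `u₁(0)` at the central vertex. -/
def vertexValue {N : ℕ} (u : Fin N → ℝ → ℂ) : ℂ := if h : 0 < N then u ⟨0, h⟩ 0 else 0

/-- The sesquilinear form `𝔉_γ[u, v] = ∑ₑ ∫ ∂ₓuₑ conj(∂ₓvₑ) dx - γ u₁(0) conj(v₁(0))` on `H¹(Γ)`;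
`-Δ_γ u` is the functional `v ↦ 𝔉_γ[u, v]`. -/
def form {N : ℕ} (γ : ℝ) (u v : Fin N → ℝ → ℂ) : ℂ :=
  (∑ e, ∫ x in Ioi (0 : ℝ), weakDeriv (u e) x * conj (weakDeriv (v e) x))
    - γ * (vertexValue u * conj (vertexValue v))

/-- The nonlinearity `z Log |z|²`, equal to `0` at `z = 0`. -/
def logNonlin (z : ℂ) : ℂ := z * (Real.log (‖z‖ ^ 2) : ℂ)

/-- The pairing of `-Δ_γ φ + ω φ - φ Log |φ|²` with `v ∈ W(Γ)`. -/
def stationaryPairing {N : ℕ} (γ ω : ℝ) (φ v : Fin N → ℝ → ℂ) : ℂ :=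
  form γ φ v
    + ω * (∑ e, ∫ x in Ioi (0 : ℝ), φ e x * conj (v e x))
    - ∑ e, ∫ x in Ioi (0 : ℝ), logNonlin (φ e x) * conj (v e x)

/-- `φ ∈ W(Γ)` solves `-Δ_γ φ + ω φ - φ Log |φ|² = 0` in the dual `W'(Γ)`: the left hand side is
the zero functional on `W(Γ)`. -/
def IsStationarySolution {N : ℕ} (γ ω : ℝ) (φ : Fin N → ℝ → ℂ) : Prop :=
  MemW φ ∧ ∀ v : Fin N → ℝ → ℂ, MemW v → stationaryPairing γ ω φ v = 0

/-- `φ` is real and strictly positive at every point of the graph. -/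
def IsPositive {N : ℕ} (φ : Fin N → ℝ → ℂ) : Prop :=
  ∀ e, ∀ x, 0 ≤ x → 0 < (φ e x).re ∧ (φ e x).im = 0

/-- The profile `φ^κ_{ω,γ}` with `h_κ = γ / (N - 2κ)`: a shifted Gaussian with its maximum inside
the edge on the first `κ` edges, and a decreasing one on the others. -/
def profile (N : ℕ) (γ ω : ℝ) (κ : ℕ) (e : Fin N) (x : ℝ) : ℝ :=
  let h : ℝ := γ / ((N : ℝ) - 2 * (κ : ℝ))
  if (e : ℕ) < κ then
    Real.exp ((ω + 1) / 2) * Real.exp (-(1 / 2) * (x - h) ^ 2)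
  else
    Real.exp ((ω + 1) / 2) * Real.exp (-(1 / 2) * (x + h) ^ 2)

/-! The integrals in `stationaryPairing` converge absolutely on `W(Γ)`. -/

theorem memL2_weakDeriv {f : ℝ → ℂ} (hf : MemH1 f) : MemL2 (weakDeriv f) := by
  unfold weakDeriv
  rw [dif_pos hf.2]
  exact hf.2.choose_spec.1

theorem isWeakDeriv_weakDeriv {f : ℝ → ℂ} (hf : MemH1 f) : IsWeakDeriv f (weakDeriv f) := by
  unfold weakDeriv
  rw [dif_pos hf.2]
  exact hf.2.choose_spec.2

theorem MemL2.integrable_mul_conj {f g : ℝ → ℂ} (hf : MemL2 f) (hg : MemL2 g) :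
    IntegrableOn (fun x => f x * conj (g x)) (Ioi 0) :=
  MemLp.integrable_mul (p := 2) (q := 2) hf hg.star

theorem abs_mul_log_le {s t : ℝ} (hs : 0 ≤ s) (ht : 0 ≤ t) :
    s * |Real.log (s ^ 2)| * t ≤
      s ^ 2 * |Real.log (s ^ 2)| + t ^ 2 * |Real.log (t ^ 2)| + 2 * t ^ 2 := by
  have ha : 0 ≤ |Real.log (s ^ 2)| := abs_nonneg _
  have hb : 0 ≤ |Real.log (t ^ 2)| := abs_nonneg _
  rcases hs.eq_or_lt with rfl | hs'
  · simp only [zero_mul]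
    positivity
  rcases le_total t s with hts | hst
  · have h1 : s * |Real.log (s ^ 2)| * t ≤ s * |Real.log (s ^ 2)| * s :=
      mul_le_mul_of_nonneg_left hts (by positivity)
    have h2 : 0 ≤ t ^ 2 * |Real.log (t ^ 2)| := by positivity
    nlinarith [sq_nonneg t]
  · have ht' : 0 < t := hs'.trans_le hst
    have hr : 1 ≤ t / s := (one_le_div hs').2 hst
    have hlog : Real.log (s ^ 2) = Real.log (t ^ 2) - 2 * Real.log (t / s) := by
      rw [Real.log_div ht'.ne' hs'.ne', Real.log_pow, Real.log_pow]
      push_cast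
      ring
    have h0 : 0 ≤ Real.log (t / s) := Real.log_nonneg hr
    have h3 : |Real.log (s ^ 2)| ≤ |Real.log (t ^ 2)| + 2 * Real.log (t / s) := by
      rw [hlog]
      refine (abs_sub _ _).trans ?_
      rw [abs_of_nonneg (by positivity : (0 : ℝ) ≤ 2 * Real.log (t / s))]
    have h4 : s * Real.log (t / s) ≤ t := by
      have h5 : Real.log (t / s) ≤ t / s := (Real.log_le_sub_one_of_pos (by positivity)).trans
        (by linarith)
      calc s * Real.log (t / s) ≤ s * (t / s) := mul_le_mul_of_nonneg_left h5 hs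
        _ = t := by field_simp
    have h6 : s * |Real.log (s ^ 2)| ≤ t * |Real.log (t ^ 2)| + 2 * t := by
      have h7 := mul_le_mul_of_nonneg_left h3 hs
      have h8 := mul_le_mul_of_nonneg_right hst hb
      nlinarith
    have h9 := mul_le_mul_of_nonneg_right h6 ht
    have h10 : 0 ≤ s ^ 2 * |Real.log (s ^ 2)| := by positivity
    nlinarith [sq_nonneg t]

theorem MemW.integrable_logNonlin {N : ℕ} {u v : Fin N → ℝ → ℂ} (hu : MemW u) (hv : MemW v)
    (e : Fin N) : IntegrableOn (fun x => logNonlin (u e x) * conj (v e x)) (Ioi 0) := by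
  have hum := (hu.memH1 e).1.aestronglyMeasurable
  have hvm := (hv.memH1 e).1.aestronglyMeasurable
  have h2 : IntegrableOn (fun x => ‖v e x‖ ^ 2) (Ioi 0) :=
    (memLp_two_iff_integrable_sq_norm hvm).1 (hv.memH1 e).1
  refine (((hu.integrable_log e).norm.add (hv.integrable_log e).norm).add (h2.const_mul 2)).mono'
    ?_ (Filter.Eventually.of_forall fun x => ?_)
  · have hl : AEStronglyMeasurable (fun x => (Real.log (‖u e x‖ ^ 2) : ℂ))
        (volume.restrict (Ioi 0)) :=
      (Complex.measurable_ofReal.comp_aemeasurable (Real.measurable_log.comp_aemeasurable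
        (hum.norm.aemeasurable.pow_const 2))).aestronglyMeasurable
    exact (hum.mul hl).mul hvm.star
  · have h := abs_mul_log_le (norm_nonneg (u e x)) (norm_nonneg (v e x))
    simpa [logNonlin, abs_mul] using h

end

end StarGraph

namespace StarGraph

open Filter Topology intervalIntegral

/-! Test functions supported inside one edge show that a solution satisfies `φ'' = ω φ - φ log φ²`
weakly there. By continuity and positivity the right side is continuous, so `φ` is twice
differentiable on `(0, ∞)` (`exists_hasDerivAt_of_isWeakDeriv_weakDeriv`). The energy `φ'² - (ω + 1)
φ² + φ² log φ²` is then constant and integrable, hence zero. This turns the equation for `p = φ'/φ`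
into `p' = -1`, so `p = b - x` and `φ` is a Gaussian centred at `b` (`exists_log_eq_of_hasDerivAt`).

Continuity at the vertex makes all `b_e²` equal, so `b_e = ±h`. Green's formula
(`edge_pairing_gausson`) reduces the pairing with `v` to boundary terms, and such a family is a
solution exactly when `∑ b_e = -γ` (`isStationarySolution_gausson_iff`). With `κ` plus signs this
reads `(N - 2κ) h = γ`, which forces `2κ < N` because `γ > 0`, and determines `h`. The vertex value
determines `h`, hence `κ`, so distinct `κ` are not permutations of each other. -/

/-! ### Integration by parts against primitives of integrable functions. -/

theorem integral_mul_eq_sub_integral_deriv_mul_primitive {F g : ℝ → ℝ} (hF : ContDiff ℝ 1 F)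
    {R : ℝ} (hg : IntervalIntegrable g volume 0 R) :
    ∫ x in (0 : ℝ)..R, F x * g x =
      F R * (∫ t in (0 : ℝ)..R, g t) - ∫ x in (0 : ℝ)..R, deriv F x * ∫ t in (0 : ℝ)..x, g t := by
  -- Since `g` is only integrable, its primitive is absolutely continuous and has derivative `g`
  -- only almost everywhere.
  have h := AbsolutelyContinuousOnInterval.integral_mul_deriv_eq_deriv_mul
    (hF.contDiffOn (s := uIcc 0 R)).absolutelyContinuousOnInterval
    (hg.absolutelyContinuousOnInterval_intervalIntegral (c := 0) (by simp))
  simp only [integral_same, mul_zero, sub_zero] at h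
  rw [← h]
  refine intervalIntegral.integral_congr_ae ?_
  filter_upwards [hg.ae_hasDerivAt_integral] with x hx hxm
  rw [(hx (uIoc_subset_uIcc hxm) 0 (by simp)).deriv]

/-- Integration by parts of a `C¹` function against the primitive of an integrable function. -/
theorem integral_smul_eq_sub_integral_deriv_smul_primitive {F : ℝ → ℝ} {g : ℝ → ℂ}
    (hF : ContDiff ℝ 1 F) {R : ℝ} (hg : IntervalIntegrable g volume 0 R) :
    ∫ x in (0 : ℝ)..R, F x • g x =
      F R • (∫ t in (0 : ℝ)..R, g t) - ∫ x in (0 : ℝ)..R, deriv F x • ∫ t in (0 : ℝ)..x, g t := by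
  have hFc : Continuous F := hF.continuous
  have hF' : Continuous (deriv F) := hF.continuous_deriv le_rfl
  have hsub : ∀ x ∈ uIcc 0 R, IntervalIntegrable g volume 0 x := fun x hx =>
    hg.mono_set (uIcc_subset_uIcc_left hx)
  have hP : IntervalIntegrable (fun x => deriv F x • ∫ t in (0 : ℝ)..x, g t) volume 0 R :=
    (hF'.continuousOn.smul (continuousOn_primitive_interval' hg (by simp))).intervalIntegrable
  have hFg : IntervalIntegrable (fun x => F x • g x) volume 0 R :=
    hg.continuousOn_smul hFc.continuousOn
  have hre : IntervalIntegrable (fun x => (g x).re) volume 0 R := ⟨hg.1.re, hg.2.re⟩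
  have him : IntervalIntegrable (fun x => (g x).im) volume 0 R := ⟨hg.1.im, hg.2.im⟩
  have ere : ∀ {f : ℝ → ℂ} {R : ℝ}, IntervalIntegrable f volume 0 R →
      (∫ t in (0 : ℝ)..R, f t).re = ∫ t in (0 : ℝ)..R, (f t).re := fun h =>
    (Complex.reCLM.intervalIntegral_comp_comm h).symm
  have eim : ∀ {f : ℝ → ℂ} {R : ℝ}, IntervalIntegrable f volume 0 R →
      (∫ t in (0 : ℝ)..R, f t).im = ∫ t in (0 : ℝ)..R, (f t).im := fun h =>
    (Complex.imCLM.intervalIntegral_comp_comm h).symm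
  apply Complex.ext
  · rw [Complex.sub_re, Complex.smul_re, ere hFg, ere hP, ere hg]
    simp only [Complex.smul_re, smul_eq_mul]
    rw [integral_mul_eq_sub_integral_deriv_mul_primitive hF hre]
    congr 1
    refine intervalIntegral.integral_congr fun x hx => ?_
    simp only [ere (hsub x hx)]
  · rw [Complex.sub_im, Complex.smul_im, eim hFg, eim hP, eim hg]
    simp only [Complex.smul_im, smul_eq_mul]
    rw [integral_mul_eq_sub_integral_deriv_mul_primitive hF him]
    congr 1
    refine intervalIntegral.integral_congr fun x hx => ?_
    simp only [eim (hsub x hx)]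

/-! ### Test functions on `(0, ∞)` and the du Bois-Reymond lemma. -/

theorem exists_Ioo_of_hasCompactSupport {ξ : ℝ → ℝ} (hc : HasCompactSupport ξ)
    (hs : tsupport ξ ⊆ Ioi 0) : ∃ a b, 0 < a ∧ a < b ∧ tsupport ξ ⊆ Ioo a b := by
  rcases (tsupport ξ).eq_empty_or_nonempty with h | h
  · exact ⟨1, 2, one_pos, one_lt_two, by simp [h]⟩
  · obtain ⟨a, ha⟩ := hc.exists_isLeast h
    obtain ⟨b, hb⟩ := hc.exists_isGreatest h
    have h0 : 0 < a := hs ha.1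
    have hab : a ≤ b := ha.2 hb.1
    exact ⟨a / 2, b + 1, by linarith, by linarith,
      fun x hx => ⟨(half_lt_self h0).trans_le (ha.2 hx), (hb.2 hx).trans_lt (lt_add_one b)⟩⟩

/-- A test function on `(0, ∞)` with zero integral is the derivative of a test function. -/
theorem exists_test_primitive {ψ : ℝ → ℝ} (hψ : ContDiff ℝ (⊤ : ℕ∞) ψ) (hc : HasCompactSupport ψ)
    (hs : tsupport ψ ⊆ Ioi 0) (h0 : ∫ x, ψ x = 0) :
    ∃ η : ℝ → ℝ, ContDiff ℝ (⊤ : ℕ∞) η ∧ HasCompactSupport η ∧ tsupport η ⊆ Ioi 0 ∧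
      deriv η = ψ := by
  obtain ⟨a, b, ha, hab, hI⟩ := exists_Ioo_of_hasCompactSupport hc hs
  have hd : ∀ x, HasDerivAt (fun x => ∫ t in a..x, ψ t) (ψ x) x := fun x =>
    integral_hasDerivAt_right (hψ.continuous.intervalIntegrable _ _)
      hψ.continuous.aestronglyMeasurable.stronglyMeasurableAtFilter hψ.continuous.continuousAt
  have hz : ∀ x, x ∉ Ioo a b → ψ x = 0 := fun x hx => image_eq_zero_of_notMem_tsupport
    fun h => hx (hI h)
  have hsupp : tsupport (fun x => ∫ t in a..x, ψ t) ⊆ Icc a b := by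
    refine closure_minimal (fun x hx => ?_) isClosed_Icc
    by_contra hn
    apply hx
    rcases lt_or_ge x a with h | h
    · have : ∫ t in a..x, ψ t = ∫ t in a..x, (0 : ℝ) := by
        refine integral_congr_ae (Eventually.of_forall fun t ht => hz t fun hn => ?_)
        rw [uIoc_of_ge h.le] at ht
        exact absurd hn.1 ht.2.not_gt
      simpa using this
    · have hbx : b < x := by
        by_contra hb
        exact hn ⟨h, not_lt.1 hb⟩
      simp only
      rw [integral_of_le h, ← h0]
      refine setIntegral_eq_integral_of_forall_compl_eq_zero fun t ht => hz t fun hn =>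
        ht ⟨hn.1, (hn.2.trans hbx).le⟩
  have hder : deriv (fun x => ∫ t in a..x, ψ t) = ψ := funext fun x => (hd x).deriv
  refine ⟨_, ?_, isCompact_Icc.of_isClosed_subset (isClosed_tsupport _) hsupp,
    hsupp.trans fun x hx => ha.trans_le hx.1, hder⟩
  rw [contDiff_infty_iff_deriv]
  exact ⟨fun x => (hd x).differentiableAt, by rwa [hder]⟩

theorem exists_test_integral_eq_one : ∃ ρ : ℝ → ℝ, ContDiff ℝ (⊤ : ℕ∞) ρ ∧ HasCompactSupport ρ ∧
    tsupport ρ ⊆ Ioi 0 ∧ ∫ x, ρ x = 1 := by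
  let f : ContDiffBump (2 : ℝ) := ⟨1 / 2, 1, by norm_num, by norm_num⟩
  refine ⟨f.normed volume, f.contDiff_normed, f.hasCompactSupport_normed, ?_, f.integral_normed⟩
  rw [f.tsupport_normed_eq, Real.closedBall_eq_Icc]
  intro x hx
  have := hx.1
  simp only [f] at this
  exact mem_Ioi.2 (by linarith)

theorem setIntegral_test_smul {ξ : ℝ → ℝ} (hs : tsupport ξ ⊆ Ioi 0) (f : ℝ → ℂ) :
    ∫ x in Ioi (0 : ℝ), ξ x • f x = ∫ x, ξ x • f x :=
  setIntegral_eq_integral_of_forall_compl_eq_zero fun x hx => by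
    rw [image_eq_zero_of_notMem_tsupport fun h => hx (hs h), zero_smul]

theorem integrable_test_smul {ξ : ℝ → ℝ} (hξ : Continuous ξ) (hc : HasCompactSupport ξ)
    (hs : tsupport ξ ⊆ Ioi 0) {f : ℝ → ℂ} (hf : LocallyIntegrableOn f (Ioi 0)) :
    Integrable (fun x => ξ x • f x) := by
  have h : IntegrableOn (fun x => ξ x • f x) (tsupport ξ) :=
    (hf.integrableOn_compact_subset hs hc).continuousOn_smul hξ.continuousOn hc
  exact (integrableOn_iff_integrable_of_support_subset
    ((Function.support_smul_subset_left _ _).trans (subset_tsupport ξ))).1 h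

/-- The du Bois-Reymond lemma: a function on `(0, ∞)` whose weak derivative vanishes is almost
everywhere constant. -/
theorem ae_eq_const_of_isWeakDeriv_zero {f : ℝ → ℂ} (hf : LocallyIntegrableOn f (Ioi 0))
    (h : IsWeakDeriv f 0) : ∃ c : ℂ, f =ᵐ[volume.restrict (Ioi 0)] fun _ => c := by
  obtain ⟨ρ, hρ, hρc, hρs, hρ1⟩ := exists_test_integral_eq_one
  refine ⟨∫ x, ρ x • f x, ?_⟩
  set c := ∫ x, ρ x • f x with hcdef
  have key := isOpen_Ioi.ae_eq_zero_of_integral_contDiff_smul_eq_zero (μ := volume)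
    (f := fun x => f x - c) (U := Ioi (0 : ℝ))
    (hf.sub ((locallyIntegrable_const c).locallyIntegrableOn _))
    (fun ξ hξ hξc hξs => ?_)
  · refine (ae_restrict_iff' measurableSet_Ioi).2 ?_
    filter_upwards [key] with x hx hx0
    exact sub_eq_zero.1 (hx hx0)
  · have hint : Integrable ξ := hξ.continuous.integrable_of_hasCompactSupport hξc
    have hρi : Integrable ρ := hρ.continuous.integrable_of_hasCompactSupport hρc
    have hs : tsupport (fun x => ξ x - (∫ t, ξ t) * ρ x) ⊆ tsupport ξ ∪ tsupport ρ := by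
      refine closure_minimal (fun x hx => ?_) ((isClosed_tsupport _).union (isClosed_tsupport _))
      by_contra hn
      rw [mem_union, not_or] at hn
      apply hx
      simp [image_eq_zero_of_notMem_tsupport hn.1, image_eq_zero_of_notMem_tsupport hn.2]
    -- Subtracting `(∫ ξ) ρ` makes the integral vanish, so the difference is `η'` for a test
    -- function `η`; testing `f` with it gives `∫ ξ f = (∫ ξ) c`.
    obtain ⟨η, hη, hηc, hηs, hη'⟩ := exists_test_primitive
      (ψ := fun x => ξ x - (∫ t, ξ t) * ρ x) (hξ.sub (contDiff_const.mul hρ))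
      ((hξc.union hρc).of_isClosed_subset (isClosed_tsupport _) hs)
      (hs.trans (union_subset hξs hρs))
      (by rw [integral_sub hint (hρi.const_mul _), MeasureTheory.integral_const_mul, hρ1, mul_one, sub_self])
    have h1 := h η hη hηc hηs
    rw [hη'] at h1
    have i1 := integrable_test_smul hξ.continuous hξc hξs hf
    have i2 := integrable_test_smul hρ.continuous hρc hρs hf
    rw [setIntegral_test_smul (hs.trans (union_subset hξs hρs))] at h1
    simp only [Pi.zero_apply, smul_zero, MeasureTheory.integral_zero, neg_zero, sub_smul, mul_smul] at h1
    have i3 : Integrable (fun x => (∫ t, ξ t) • ρ x • f x) :=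
      i2.smul (∫ t, ξ t)
    rw [integral_sub i1 i3, MeasureTheory.integral_smul, ← hcdef] at h1
    simp only [smul_sub]
    rw [integral_sub i1 (hint.smul_const c), _root_.integral_smul_const]
    exact h1

/-! ### Functions in `H¹` as primitives of their weak derivatives. -/

theorem MemL2.intervalIntegrable {f : ℝ → ℂ} (hf : MemL2 f) {R : ℝ} (hR : 0 ≤ R) :
    IntervalIntegrable f volume 0 R := by
  rw [intervalIntegrable_iff_integrableOn_Ioc_of_le hR]
  exact (hf.mono_measure (Measure.restrict_mono Ioc_subset_Ioi_self le_rfl)).integrable one_le_two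

theorem MemL2.locallyIntegrableOn {f : ℝ → ℂ} (hf : MemL2 f) : LocallyIntegrableOn f (Ioi 0) :=
  locallyIntegrableOn_of_locallyIntegrable_restrict (MemLp.locallyIntegrable hf one_le_two)

theorem setIntegral_test_smul_eq_intervalIntegral {ξ : ℝ → ℝ} {a b : ℝ} (ha : 0 < a) (hab : a < b)
    (hs : tsupport ξ ⊆ Ioo a b) (f : ℝ → ℂ) :
    ∫ x in Ioi (0 : ℝ), ξ x • f x = ∫ x in (0 : ℝ)..b, ξ x • f x := by
  rw [setIntegral_test_smul (hs.trans fun x hx => ha.trans hx.1), integral_of_le (ha.trans hab).le]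
  refine (setIntegral_eq_integral_of_forall_compl_eq_zero fun x hx => ?_).symm
  rw [image_eq_zero_of_notMem_tsupport fun h => hx ⟨ha.trans (hs h).1, (hs h).2.le⟩, zero_smul]

theorem isWeakDeriv_of_hasDerivAt {f f' : ℝ → ℂ} (h : ∀ x, HasDerivAt f (f' x) x)
    (hf' : Continuous f') : IsWeakDeriv f f' := by
  intro ξ hξ hc hs
  obtain ⟨a, b, ha, hab, hI⟩ := exists_Ioo_of_hasCompactSupport hc hs
  rw [setIntegral_test_smul_eq_intervalIntegral ha hab (tsupport_deriv_subset.trans hI),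
    setIntegral_test_smul_eq_intervalIntegral ha hab hI]
  have h' := integral_smul_deriv_eq_deriv_smul (a := 0) (b := b) (u := ξ) (u' := deriv ξ) (v := f)
    (v' := f') (fun x _ => (hξ.differentiable (by simp) x).hasDerivAt) (fun x _ => h x)
    ((hξ.continuous_deriv (by simp)).intervalIntegrable _ _) (hf'.intervalIntegrable _ _)
  rw [image_eq_zero_of_notMem_tsupport fun h => (hI h).2.ne rfl,
    image_eq_zero_of_notMem_tsupport fun h => ha.not_gt (hI h).1] at h'
  rw [h']
  simp

theorem continuousOn_primitive_Ici {g : ℝ → ℂ} (hg : ∀ R, 0 ≤ R → IntervalIntegrable g volume 0 R) :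
    ContinuousOn (fun x => ∫ t in (0 : ℝ)..x, g t) (Ici 0) := by
  intro x hx
  have hx : 0 ≤ x := hx
  have h1 : ContinuousOn (fun x => ∫ t in (0 : ℝ)..x, g t) (uIcc 0 (x + 1)) :=
    continuousOn_primitive_interval' (hg (x + 1) (by positivity)) (by simp)
  rw [uIcc_of_le (by positivity)] at h1
  refine (h1 x ⟨hx, (lt_add_one x).le⟩).mono_of_mem_nhdsWithin ?_
  rw [← Ici_inter_Iic]
  exact inter_mem self_mem_nhdsWithin (mem_nhdsWithin_of_mem_nhds (Iic_mem_nhds (lt_add_one x)))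

/-- A function with locally integrable weak derivative is almost everywhere a primitive of it. -/
theorem IsWeakDeriv.ae_eq_primitive {f g : ℝ → ℂ} (h : IsWeakDeriv f g)
    (hf : LocallyIntegrableOn f (Ioi 0)) (hg : ∀ R, 0 ≤ R → IntervalIntegrable g volume 0 R) :
    ∃ c : ℂ, f =ᵐ[volume.restrict (Ioi 0)] fun x => c + ∫ t in (0 : ℝ)..x, g t := by
  have hP := (continuousOn_primitive_Ici hg).mono Ioi_subset_Ici_self
  have hPl := hP.locallyIntegrableOn (μ := volume) measurableSet_Ioi
  -- The primitive of `g` also has weak derivative `g`, so its difference from `f` has weak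
  -- derivative zero.
  obtain ⟨c, hc⟩ := ae_eq_const_of_isWeakDeriv_zero (hf.sub hPl) fun ξ hξ hξc hξs => by
    obtain ⟨a, b, ha, hab, hI⟩ := exists_Ioo_of_hasCompactSupport hξc hξs
    have hdc := hξ.continuous_deriv (by simp)
    have hds := tsupport_deriv_subset.trans hξs
    have h1 := integral_smul_eq_sub_integral_deriv_smul_primitive
      (hξ.of_le (by norm_cast)) (hg b (ha.trans hab).le)
    rw [image_eq_zero_of_notMem_tsupport fun h => (hI h).2.ne rfl, zero_smul, zero_sub,
      ← setIntegral_test_smul_eq_intervalIntegral ha hab hI,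
      ← setIntegral_test_smul_eq_intervalIntegral ha hab (tsupport_deriv_subset.trans hI)] at h1
    have i1 := (integrable_test_smul hdc hξc.deriv hds hf).integrableOn (s := Ioi 0)
    have i2 := (integrable_test_smul hdc hξc.deriv hds hPl).integrableOn (s := Ioi 0)
    simp only [Pi.sub_apply, smul_sub, Pi.zero_apply, smul_zero, MeasureTheory.integral_zero,
      neg_zero]
    rw [MeasureTheory.integral_sub i1 i2, h ξ hξ hξc hξs, h1]
    ring
  refine ⟨c, hc.mono fun x hx => ?_⟩
  exact sub_eq_iff_eq_add.1 hx

theorem IsWeakDeriv.ae_unique {f g₁ g₂ : ℝ → ℂ} (h₁ : IsWeakDeriv f g₁) (h₂ : IsWeakDeriv f g₂)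
    (hg₁ : MemL2 g₁) (hg₂ : MemL2 g₂) : g₁ =ᵐ[volume.restrict (Ioi 0)] g₂ := by
  have key := isOpen_Ioi.ae_eq_zero_of_integral_contDiff_smul_eq_zero (μ := volume)
    (hg₁.locallyIntegrableOn.sub hg₂.locallyIntegrableOn) (fun ξ hξ hξc hξs => ?_)
  · refine (ae_restrict_iff' measurableSet_Ioi).2 ?_
    filter_upwards [key] with x hx hx0
    exact sub_eq_zero.1 (hx hx0)
  · have i1 := integrable_test_smul hξ.continuous hξc hξs hg₁.locallyIntegrableOn
    have i2 := integrable_test_smul hξ.continuous hξc hξs hg₂.locallyIntegrableOn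
    simp only [Pi.sub_apply, smul_sub]
    rw [MeasureTheory.integral_sub i1 i2, ← setIntegral_test_smul hξs, ← setIntegral_test_smul hξs,
      sub_eq_zero]
    exact neg_injective ((h₁ ξ hξ hξc hξs).symm.trans (h₂ ξ hξ hξc hξs))

/-- `weakDeriv` is an arbitrary choice; this lets an explicit derivative replace it under integrals.
-/
theorem weakDeriv_ae_eq {f g : ℝ → ℂ} (hg : MemL2 g) (h : IsWeakDeriv f g) (hf : MemL2 f) :
    weakDeriv f =ᵐ[volume.restrict (Ioi 0)] g :=
  have hf : MemH1 f := ⟨hf, g, hg, h⟩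
  (isWeakDeriv_weakDeriv hf).ae_unique h (memL2_weakDeriv hf) hg

theorem eqOn_Ici_of_ae_eq {f g : ℝ → ℂ} (hf : ContinuousOn f (Ici 0)) (hg : ContinuousOn g (Ici 0))
    (h : f =ᵐ[volume.restrict (Ioi 0)] g) : EqOn f g (Ici 0) := by
  -- The endpoint is a null set, so the equality may be read on `[0, ∞)`, where continuity makes it
  -- pointwise, including at the vertex.
  rw [Measure.restrict_congr_set Ioi_ae_eq_Ici] at h
  exact Measure.eqOn_of_ae_eq h hf hg (by simp)

theorem eq_add_integral_weakDeriv {f : ℝ → ℂ} (hf : MemH1 f) (hc : ContinuousOn f (Ici 0)) {x : ℝ}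
    (hx : 0 ≤ x) : f x = f 0 + ∫ t in (0 : ℝ)..x, weakDeriv f t := by
  have hi : ∀ R, 0 ≤ R → IntervalIntegrable (weakDeriv f) volume 0 R := fun R hR =>
    (memL2_weakDeriv hf).intervalIntegrable hR
  obtain ⟨c, h⟩ := (isWeakDeriv_weakDeriv hf).ae_eq_primitive hf.1.locallyIntegrableOn hi
  have he := eqOn_Ici_of_ae_eq hc (continuousOn_const.add (continuousOn_primitive_Ici hi)) h
  have h0 := he (self_mem_Ici (a := (0 : ℝ)))
  simp only [Pi.add_apply, integral_same, add_zero] at h0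
  rw [h0]
  exact he hx

/-- Integration by parts on `(0, ∞)` of a `C¹` function in `H¹` against a function in `H¹`. -/
theorem setIntegral_smul_weakDeriv {v : ℝ → ℂ} (hv : MemH1 v) (hc : ContinuousOn v (Ici 0))
    {F : ℝ → ℝ} (hF : ContDiff ℝ 1 F) (hF0 : MemLp F 2 (volume.restrict (Ioi 0)))
    (hF1 : MemLp (deriv F) 2 (volume.restrict (Ioi 0))) :
    ∫ x in Ioi (0 : ℝ), F x • weakDeriv v x
      = -(F 0 • v 0) - ∫ x in Ioi (0 : ℝ), deriv F x • v x := by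
  have hi : ∀ R, 0 ≤ R → IntervalIntegrable (weakDeriv v) volume 0 R := fun R hR =>
    (memL2_weakDeriv hv).intervalIntegrable hR
  have hF' : Continuous (deriv F) := hF.continuous_deriv le_rfl
  have i1 : IntegrableOn (fun x => F x • weakDeriv v x) (Ioi 0) :=
    memLp_one_iff_integrable.1 (MemLp.smul (p := 2) (q := 2) (r := 1) (memL2_weakDeriv hv) hF0)
  have i2 : IntegrableOn (fun x => deriv F x • v x) (Ioi 0) :=
    memLp_one_iff_integrable.1 (MemLp.smul (p := 2) (q := 2) (r := 1) hv.1 hF1)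
  have i3 : IntegrableOn (fun x => F x • v x) (Ioi 0) :=
    memLp_one_iff_integrable.1 (MemLp.smul (p := 2) (q := 2) (r := 1) hv.1 hF0)
  have key : ∀ R, 0 ≤ R → F R • v R = (∫ x in (0 : ℝ)..R, F x • weakDeriv v x) + F 0 • v 0
      + ∫ x in (0 : ℝ)..R, deriv F x • v x := by
    intro R hR
    have h1 : ∫ x in (0 : ℝ)..R, deriv F x • ∫ t in (0 : ℝ)..x, weakDeriv v t
        = ∫ x in (0 : ℝ)..R, (deriv F x • v x - deriv F x • v 0) := by
      refine intervalIntegral.integral_congr fun x hx => ?_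
      rw [uIcc_of_le hR] at hx
      rw [eq_add_integral_weakDeriv hv hc hx.1]
      simp [smul_add]
    have hvi : ContinuousOn v (uIcc 0 R) :=
      hc.mono (by rw [uIcc_of_le hR]; exact Icc_subset_Ici_self)
    have j1 : IntervalIntegrable (fun x => deriv F x • v x) volume 0 R :=
      (hF'.continuousOn.smul hvi).intervalIntegrable
    have j2 : IntervalIntegrable (fun x => deriv F x • v 0) volume 0 R :=
      (hF'.smul continuous_const).intervalIntegrable _ _
    rw [integral_smul_eq_sub_integral_deriv_smul_primitive hF (hi R hR), h1,
      intervalIntegral.integral_sub j1 j2,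
      intervalIntegral.integral_smul_const,
      integral_deriv_eq_sub (fun x _ => hF.differentiable one_ne_zero x)
        (hF'.intervalIntegrable _ _)]
    rw [eq_add_integral_weakDeriv hv hc hR, smul_add, sub_smul]
    ring
  have hlim : Tendsto (fun R => F R • v R) atTop (𝓝 ((∫ x in Ioi (0 : ℝ), F x • weakDeriv v x)
      + F 0 • v 0 + ∫ x in Ioi (0 : ℝ), deriv F x • v x)) := by
    refine Tendsto.congr' ?_ (((intervalIntegral_tendsto_integral_Ioi 0 i1 tendsto_id).add_const
      (F 0 • v 0)).add (intervalIntegral_tendsto_integral_Ioi 0 i2 tendsto_id))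
    filter_upwards [eventually_ge_atTop 0] with R hR
    exact (key R hR).symm
  -- The boundary term `F R • v R` has a limit because both integrals converge; as `F • v` is
  -- integrable on a half-line, that limit is zero.
  have h0 := IntegrableAtFilter.eq_zero_of_tendsto (μ := volume) ⟨Ioi 0, Ioi_mem_atTop 0, i3⟩
    (fun s hs => by
      obtain ⟨b, hb⟩ := mem_atTop_sets.1 hs
      exact top_unique ((Real.volume_Ici (a := b)).symm.le.trans (measure_mono hb))) hlim
  linear_combination h0

/-! ### Calculus of the shifted Gaussian. -/

/-- The Gaussian `e^((ω+1)/2) e^(-(x-b)²/2)`. -/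
noncomputable def gausson (ω b x : ℝ) : ℝ :=
  Real.exp ((ω + 1) / 2) * Real.exp (-(1 / 2) * (x - b) ^ 2)

theorem gausson_pos (ω b x : ℝ) : 0 < gausson ω b x := by
  unfold gausson
  positivity

theorem gausson_zero_congr (ω : ℝ) {b c : ℝ} (h : b ^ 2 = c ^ 2) :
    gausson ω b 0 = gausson ω c 0 := by
  simp [gausson, h]

theorem log_gausson_sq (ω b x : ℝ) : Real.log (gausson ω b x ^ 2) = ω + 1 - (x - b) ^ 2 := by
  rw [Real.log_pow, gausson, ← Real.exp_add, Real.log_exp]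
  push_cast
  ring

theorem hasDerivAt_gausson (ω b x : ℝ) :
    HasDerivAt (gausson ω b) (-(x - b) * gausson ω b x) x := by
  have h := (((((hasDerivAt_id x).sub_const b).pow 2).const_mul (-(1 / 2) : ℝ)).exp).const_mul
    (Real.exp ((ω + 1) / 2))
  convert! h using 1
  simp only [gausson, Pi.pow_apply, id]
  push_cast
  ring

/-- By `log_gausson_sq` this second derivative equals `ω G - G log G²` for the Gaussian `G`: the
edge equation holds for every centre `b`. -/
theorem hasDerivAt_deriv_gausson (ω b x : ℝ) :
    HasDerivAt (fun x => -(x - b) * gausson ω b x) (((x - b) ^ 2 - 1) * gausson ω b x) x := by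
  have h := (((hasDerivAt_id x).sub_const b).neg).mul (hasDerivAt_gausson ω b x)
  convert! h using 1
  simp
  ring

theorem contDiff_gausson (ω b : ℝ) : ContDiff ℝ 1 (gausson ω b) := by
  unfold gausson
  fun_prop

theorem integrable_pow_mul_gausson_sq (ω b : ℝ) (n : ℕ) :
    Integrable (fun x => (x - b) ^ n * gausson ω b x ^ 2) := by
  have h := ((integrable_rpow_mul_exp_neg_mul_sq (b := 1) one_pos (s := n)
    (by linarith [n.cast_nonneg (α := ℝ)])).comp_sub_right b).const_mul
    (Real.exp ((ω + 1) / 2) ^ 2)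
  refine h.congr (Eventually.of_forall fun x => ?_)
  simp only [gausson, Real.rpow_natCast]
  have : Real.exp (-1 * (x - b) ^ 2) = Real.exp (-(1 / 2) * (x - b) ^ 2) ^ 2 := by
    rw [← Real.exp_nat_mul]
    congr 1
    push_cast
    ring
  rw [this]
  ring

/-- Degrees 0, 1 and 2 give the Gaussian and its first two derivatives in `L²`. -/
theorem memLp_pow_mul_gausson (ω b : ℝ) (n : ℕ) :
    MemLp (fun x => (x - b) ^ n * gausson ω b x) 2 (volume.restrict (Ioi 0)) := by
  have hc : Continuous (fun x => (x - b) ^ n * gausson ω b x) :=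
    (by fun_prop : Continuous fun x : ℝ => (x - b) ^ n).mul (contDiff_gausson ω b).continuous
  rw [memLp_two_iff_integrable_sq hc.aestronglyMeasurable]
  refine ((integrable_pow_mul_gausson_sq ω b (n * 2)).integrableOn (s := Ioi 0)).congr
    (Eventually.of_forall fun x => ?_)
  simp only
  ring

theorem memLp_gausson (ω b : ℝ) : MemLp (gausson ω b) 2 (volume.restrict (Ioi 0)) := by
  simpa using memLp_pow_mul_gausson ω b 0

theorem memLp_deriv_gausson (ω b : ℝ) :
    MemLp (fun x => -(x - b) * gausson ω b x) 2 (volume.restrict (Ioi 0)) := by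
  convert! (memLp_pow_mul_gausson ω b 1).neg using 1
  funext x
  simp only [Pi.neg_apply]
  ring

theorem memLp_deriv_deriv_gausson (ω b : ℝ) :
    MemLp (fun x => ((x - b) ^ 2 - 1) * gausson ω b x) 2 (volume.restrict (Ioi 0)) := by
  convert! (memLp_pow_mul_gausson ω b 2).sub (memLp_gausson ω b) using 1
  funext x
  simp only [Pi.sub_apply]
  ring

/-! ### A Gaussian on a single edge. -/

section

variable {ω b : ℝ} {f : ℝ → ℂ}

/-- Agreement is assumed on `[0, ∞)` only, since negative arguments carry no meaning on the graph.
-/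
theorem ae_eq_of_eqOn_gausson (hf : ∀ x, 0 ≤ x → f x = gausson ω b x) :
    f =ᵐ[volume.restrict (Ioi 0)] fun x => (gausson ω b x : ℂ) :=
  (ae_restrict_iff' measurableSet_Ioi).2 (Eventually.of_forall fun x hx => hf x (le_of_lt hx))

theorem memL2_of_eqOn_gausson (hf : ∀ x, 0 ≤ x → f x = gausson ω b x) : MemL2 f :=
  (memLp_gausson ω b).ofReal.ae_eq (ae_eq_of_eqOn_gausson hf).symm

theorem IsWeakDeriv.congr {f₁ f₂ g₁ g₂ : ℝ → ℂ} (h : IsWeakDeriv f₁ g₁)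
    (hf : f₁ =ᵐ[volume.restrict (Ioi 0)] f₂) (hg : g₁ =ᵐ[volume.restrict (Ioi 0)] g₂) :
    IsWeakDeriv f₂ g₂ := by
  intro ξ h1 h2 h3
  have e1 : ∫ x in Ioi (0 : ℝ), deriv ξ x • f₁ x = ∫ x in Ioi (0 : ℝ), deriv ξ x • f₂ x :=
    integral_congr_ae (hf.mono fun x hx => by simp only [hx])
  have e2 : ∫ x in Ioi (0 : ℝ), ξ x • g₁ x = ∫ x in Ioi (0 : ℝ), ξ x • g₂ x :=
    integral_congr_ae (hg.mono fun x hx => by simp only [hx])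
  rw [← e1, ← e2]
  exact h ξ h1 h2 h3

theorem isWeakDeriv_of_eqOn_gausson (hf : ∀ x, 0 ≤ x → f x = gausson ω b x) :
    IsWeakDeriv f (fun x => ((-(x - b) * gausson ω b x : ℝ) : ℂ)) := by
  refine (isWeakDeriv_of_hasDerivAt (fun x => (hasDerivAt_gausson ω b x).ofReal_comp) ?_).congr
    (ae_eq_of_eqOn_gausson hf).symm (ae_eq_refl _)
  exact Complex.continuous_ofReal.comp
    ((by fun_prop : Continuous fun x : ℝ => -(x - b)).mul (contDiff_gausson ω b).continuous)

theorem memH1_of_eqOn_gausson (hf : ∀ x, 0 ≤ x → f x = gausson ω b x) : MemH1 f :=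
  ⟨memL2_of_eqOn_gausson hf, _, (memLp_deriv_gausson ω b).ofReal, isWeakDeriv_of_eqOn_gausson hf⟩

theorem weakDeriv_of_eqOn_gausson (hf : ∀ x, 0 ≤ x → f x = gausson ω b x) :
    weakDeriv f =ᵐ[volume.restrict (Ioi 0)] fun x => ((-(x - b) * gausson ω b x : ℝ) : ℂ) :=
  weakDeriv_ae_eq (memLp_deriv_gausson ω b).ofReal (isWeakDeriv_of_eqOn_gausson hf)
    (memL2_of_eqOn_gausson hf)

theorem continuousOn_of_eqOn_gausson (hf : ∀ x, 0 ≤ x → f x = gausson ω b x) :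
    ContinuousOn f (Ici 0) :=
  (Complex.continuous_ofReal.comp (contDiff_gausson ω b).continuous).continuousOn.congr hf

theorem integrable_log_of_eqOn_gausson (hf : ∀ x, 0 ≤ x → f x = gausson ω b x) :
    IntegrableOn (fun x => ‖f x‖ ^ 2 * Real.log (‖f x‖ ^ 2)) (Ioi 0) := by
  have h := ((integrable_pow_mul_gausson_sq ω b 0).const_mul (ω + 1)).sub
    (integrable_pow_mul_gausson_sq ω b 2)
  refine (h.integrableOn (s := Ioi 0)).congr_fun (fun x hx => ?_) measurableSet_Ioi
  simp only [Pi.sub_apply]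
  rw [hf x (le_of_lt hx), Complex.norm_real, Real.norm_of_nonneg (gausson_pos ω b x).le,
    log_gausson_sq]
  ring

theorem setIntegral_ofReal_mul_conj (F : ℝ → ℝ) (v : ℝ → ℂ) :
    ∫ x in Ioi (0 : ℝ), (F x : ℂ) * conj (v x) = conj (∫ x in Ioi (0 : ℝ), F x • v x) := by
  rw [← integral_conj]
  simp

/-- Green's formula on an edge for a Gaussian. -/
theorem edge_pairing_gausson (hf : ∀ x, 0 ≤ x → f x = gausson ω b x) {v : ℝ → ℂ} (hv : MemH1 v)
    (hc : ContinuousOn v (Ici 0)) :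
    (∫ x in Ioi (0 : ℝ), weakDeriv f x * conj (weakDeriv v x))
      + ω * (∫ x in Ioi (0 : ℝ), f x * conj (v x))
      - ∫ x in Ioi (0 : ℝ), logNonlin (f x) * conj (v x)
      = -(b * gausson ω b 0 * conj (v 0)) := by
  have hd : deriv (fun x => -(x - b) * gausson ω b x) =
      fun x => ((x - b) ^ 2 - 1) * gausson ω b x :=
    funext fun x => (hasDerivAt_deriv_gausson ω b x).deriv
  -- Integration by parts is applied to `G'`, whose value at the vertex is `b G(0)`; this is the
  -- source of the boundary term.
  have hparts := setIntegral_smul_weakDeriv hv hc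
    ((by fun_prop : ContDiff ℝ 1 fun x : ℝ => -(x - b)).mul (contDiff_gausson ω b))
    (memLp_deriv_gausson ω b) (hd ▸ memLp_deriv_deriv_gausson ω b)
  rw [hd] at hparts
  have e1 : ∫ x in Ioi (0 : ℝ), weakDeriv f x * conj (weakDeriv v x)
      = ∫ x in Ioi (0 : ℝ), ((-(x - b) * gausson ω b x : ℝ) : ℂ) * conj (weakDeriv v x) :=
    integral_congr_ae ((weakDeriv_of_eqOn_gausson hf).mono fun x hx => by simp only [hx])
  -- The edge equation in the form `G log G² = ω G - G''`; the `ω` terms and the `G''` terms then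
  -- cancel.
  have e2 : ∫ x in Ioi (0 : ℝ), logNonlin (f x) * conj (v x)
      = ∫ x in Ioi (0 : ℝ), (ω * (f x * conj (v x))
        - ((((x - b) ^ 2 - 1) * gausson ω b x : ℝ) : ℂ) * conj (v x)) := by
    refine setIntegral_congr_fun measurableSet_Ioi fun x hx => ?_
    simp only [logNonlin]
    rw [hf x (le_of_lt hx), Complex.norm_real, Real.norm_of_nonneg (gausson_pos ω b x).le,
      log_gausson_sq]
    push_cast
    ring
  have i1 : IntegrableOn (fun x => ω * (f x * conj (v x))) (Ioi 0) :=
    ((memL2_of_eqOn_gausson hf).integrable_mul_conj hv.1).const_mul _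
  have i2 : IntegrableOn (fun x => ((((x - b) ^ 2 - 1) * gausson ω b x : ℝ) : ℂ) * conj (v x))
      (Ioi 0) := MemL2.integrable_mul_conj (memLp_deriv_deriv_gausson ω b).ofReal hv.1
  rw [e1, e2, MeasureTheory.integral_sub i1 i2, MeasureTheory.integral_const_mul,
    setIntegral_ofReal_mul_conj, setIntegral_ofReal_mul_conj, hparts]
  simp
  ring

end

/-! ### Families of Gaussians on the graph and the jump condition. -/

section

variable {N : ℕ} {ω h : ℝ} {b : Fin N → ℝ} {φ : Fin N → ℝ → ℂ}

/-- The vertex value depends on `b e` only through its square, so equal squares give continuity at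
the vertex. -/
theorem memW_of_eqOn_gausson (hb : ∀ e, b e ^ 2 = h ^ 2)
    (hφ : ∀ e x, 0 ≤ x → φ e x = gausson ω (b e) x) : MemW φ where
  memH1 e := memH1_of_eqOn_gausson (hφ e)
  continuousOn e := continuousOn_of_eqOn_gausson (hφ e)
  vertex e r := by
    rw [hφ e 0 le_rfl, hφ r 0 le_rfl, gausson_zero_congr ω (hb e), gausson_zero_congr ω (hb r)]
  integrable_log e := integrable_log_of_eqOn_gausson (hφ e)

theorem MemH1Graph.eq_vertexValue {u : Fin N → ℝ → ℂ} (hu : MemH1Graph u) (e : Fin N) :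
    u e 0 = vertexValue u := by
  rw [vertexValue, dif_pos e.pos]
  exact hu.vertex _ _

theorem stationaryPairing_eq_sum (γ ω : ℝ) (φ v : Fin N → ℝ → ℂ) :
    stationaryPairing γ ω φ v =
      (∑ e, ((∫ x in Ioi (0 : ℝ), weakDeriv (φ e) x * conj (weakDeriv (v e) x))
      + ω * (∫ x in Ioi (0 : ℝ), φ e x * conj (v e x))
      - ∫ x in Ioi (0 : ℝ), logNonlin (φ e x) * conj (v e x)))
      - γ * (vertexValue φ * conj (vertexValue v)) := by
  rw [stationaryPairing, form, Finset.sum_sub_distrib, Finset.sum_add_distrib, Finset.mul_sum]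
  ring

theorem stationaryPairing_gausson (hN : 0 < N) (γ : ℝ) (hb : ∀ e, b e ^ 2 = h ^ 2)
    (hφ : ∀ e x, 0 ≤ x → φ e x = gausson ω (b e) x) {v : Fin N → ℝ → ℂ} (hv : MemW v) :
    stationaryPairing γ ω φ v
      = -((((∑ e, b e) + γ) * gausson ω h 0 : ℝ) * conj (vertexValue v)) := by
  have hφv : vertexValue φ = gausson ω h 0 := by
    rw [← (memW_of_eqOn_gausson hb hφ).eq_vertexValue ⟨0, hN⟩, hφ _ 0 le_rfl,
      gausson_zero_congr ω (hb _)]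
  rw [stationaryPairing_eq_sum, hφv]
  have : ∀ e ∈ Finset.univ, ((∫ x in Ioi (0 : ℝ), weakDeriv (φ e) x * conj (weakDeriv (v e) x))
      + ω * (∫ x in Ioi (0 : ℝ), φ e x * conj (v e x))
      - ∫ x in Ioi (0 : ℝ), logNonlin (φ e x) * conj (v e x))
      = b e * (-(gausson ω h 0 * conj (vertexValue v))) := fun e _ => by
    rw [edge_pairing_gausson (hφ e) (hv.memH1 e) (hv.continuousOn e), hv.eq_vertexValue,
      gausson_zero_congr ω (hb e)]
    ring
  rw [Finset.sum_congr rfl this, ← Finset.sum_mul]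
  push_cast
  ring

/-- A family of Gaussians with the same value at the vertex is a solution if and only if it
satisfies the jump condition there. -/
theorem isStationarySolution_gausson_iff (hN : 0 < N) (γ : ℝ) (hb : ∀ e, b e ^ 2 = h ^ 2)
    (hφ : ∀ e x, 0 ≤ x → φ e x = gausson ω (b e) x) :
    IsStationarySolution γ ω φ ↔ ∑ e, b e = -γ := by
  have hW := memW_of_eqOn_gausson hb hφ
  constructor
  · intro hs
    -- Testing with `φ` itself is enough, because its vertex value is positive and can be divided
    -- out.
    have h1 := hs.2 φ hW
    have hφv : vertexValue φ = gausson ω h 0 := by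
      rw [← hW.eq_vertexValue ⟨0, hN⟩, hφ _ 0 le_rfl, gausson_zero_congr ω (hb _)]
    rw [stationaryPairing_gausson hN γ hb hφ hW, hφv, Complex.conj_ofReal, neg_eq_zero] at h1
    norm_cast at h1
    have hp := (gausson_pos ω h 0).ne'
    have := (mul_eq_zero.1 ((mul_eq_zero.1 h1).resolve_right hp)).resolve_right hp
    linarith
  · intro hs
    refine ⟨hW, fun v hv => ?_⟩
    rw [stationaryPairing_gausson hN γ hb hφ hv, hs]
    simp

end

/-! ### Regularity and classification of positive solutions on an edge. -/

theorem hasDerivAt_primitive_of_continuousOn_Ici {g : ℝ → ℂ} (hg : ContinuousOn g (Ici 0)) {x : ℝ}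
    (hx : 0 < x) : HasDerivAt (fun x => ∫ t in (0 : ℝ)..x, g t) (g x) x := by
  refine integral_hasDerivAt_right ?_ ?_ (hg.continuousAt (Ici_mem_nhds hx))
  · exact (hg.mono (by rw [uIcc_of_le hx.le]; exact Icc_subset_Ici_self)).intervalIntegrable
  · exact (hg.mono Ioi_subset_Ici_self).stronglyMeasurableAtFilter isOpen_Ioi x hx

/-- A function in `H¹` whose weak derivative has a continuous weak derivative is twice
differentiable in `(0, ∞)`. -/
theorem exists_hasDerivAt_of_isWeakDeriv_weakDeriv {f q : ℝ → ℂ} (hf : MemH1 f)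
    (hc : ContinuousOn f (Ici 0)) (hq : ContinuousOn q (Ici 0)) (h : IsWeakDeriv (weakDeriv f) q) :
    ∃ g : ℝ → ℂ, MemL2 g ∧ ∀ x, 0 < x → HasDerivAt f (g x) x ∧ HasDerivAt g (q x) x := by
  have hqi : ∀ R, 0 ≤ R → IntervalIntegrable q volume 0 R := fun R hR =>
    (hq.mono (by rw [uIcc_of_le hR]; exact Icc_subset_Ici_self)).intervalIntegrable
  have hL := memL2_weakDeriv hf
  obtain ⟨c, hae⟩ := h.ae_eq_primitive hL.locallyIntegrableOn hqi
  have hg : ContinuousOn (fun x => c + ∫ t in (0 : ℝ)..x, q t) (Ici 0) :=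
    continuousOn_const.add (continuousOn_primitive_Ici hqi)
  -- The witness is the continuous representative of the weak derivative; `f` is its primitive,
  -- hence classically differentiable.
  refine ⟨fun x => c + ∫ t in (0 : ℝ)..x, q t, hL.ae_eq hae, fun x hx => ⟨?_,
    (hasDerivAt_primitive_of_continuousOn_Ici hq hx).const_add c⟩⟩
  refine ((hasDerivAt_primitive_of_continuousOn_Ici hg hx).const_add (f 0)).congr_of_eventuallyEq ?_
  filter_upwards [Ioi_mem_nhds hx] with y hy
  have hy : 0 < y := hy
  rw [eq_add_integral_weakDeriv hf hc hy.le]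
  congr 1
  refine integral_congr_ae ?_
  rw [uIoc_of_le hy.le]
  filter_upwards [(ae_restrict_iff' measurableSet_Ioi).1 hae] with t ht htm
  exact ht htm.1

theorem eq_of_hasDerivAt_zero_Ioi {F : ℝ → ℝ} (h : ∀ x, 0 < x → HasDerivAt F 0 x) {x y : ℝ}
    (hx : 0 < x) (hy : 0 < y) : F x = F y :=
  isOpen_Ioi.is_const_of_deriv_eq_zero isPreconnected_Ioi
    (fun z hz => (h z hz).differentiableAt.differentiableWithinAt) (fun z hz => (h z hz).deriv) hx hy

/-- The positive `H¹` solutions of `u'' = ω u - u log u²` on `(0, ∞)` are translates of a single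
Gaussian. -/
theorem exists_log_eq_of_hasDerivAt {ω : ℝ} {u g : ℝ → ℝ} (hpos : ∀ x, 0 < x → 0 < u x)
    (hu : ∀ x, 0 < x → HasDerivAt u (g x) x)
    (hg : ∀ x, 0 < x → HasDerivAt g (ω * u x - u x * Real.log (u x ^ 2)) x)
    (iu : IntegrableOn (fun x => u x ^ 2) (Ioi 0)) (ig : IntegrableOn (fun x => g x ^ 2) (Ioi 0))
    (il : IntegrableOn (fun x => u x ^ 2 * Real.log (u x ^ 2)) (Ioi 0)) :
    ∃ b : ℝ, ∀ x, 0 < x → Real.log (u x) = (ω + 1) / 2 - 1 / 2 * (x - b) ^ 2 := by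
  have hl : ∀ x, Real.log (u x ^ 2) = 2 * Real.log (u x) := fun x => by
    rw [Real.log_pow]; norm_num
  -- First integral, obtained by multiplying the equation by `2 u'`.
  have hE : ∀ x, 0 < x → HasDerivAt
      (fun x => g x ^ 2 - (ω + 1) * u x ^ 2 + u x ^ 2 * Real.log (u x ^ 2)) 0 x := by
    intro x hx
    have hx0 := (hpos x hx).ne'
    have h1 := (hu x hx).pow 2
    have h2 := (((hg x hx).pow 2).sub (h1.const_mul (ω + 1))).add
      (h1.mul (h1.log (pow_ne_zero 2 hx0)))
    convert! h2 using 1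
    simp only [Pi.pow_apply]
    field_simp
    push_cast
    ring
  -- A constant that is integrable on a set of infinite measure is zero.
  have hE0 : ∀ x, 0 < x → g x ^ 2 - (ω + 1) * u x ^ 2 + u x ^ 2 * Real.log (u x ^ 2) = 0 := by
    intro x hx
    have hint : IntegrableOn
        (fun x => g x ^ 2 - (ω + 1) * u x ^ 2 + u x ^ 2 * Real.log (u x ^ 2)) (Ioi 0) :=
      (ig.sub (iu.const_mul (ω + 1))).add il
    refine IntegrableAtFilter.eq_zero_of_tendsto (μ := volume) (l := atTop)
      ⟨Ioi 0, Ioi_mem_atTop 0, hint⟩ (fun s hs => ?_) (tendsto_const_nhds.congr' ?_)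
    · obtain ⟨b, hb⟩ := mem_atTop_sets.1 hs
      exact top_unique ((Real.volume_Ici (a := b)).symm.le.trans (measure_mono hb))
    · filter_upwards [eventually_gt_atTop 0] with y hy
      exact eq_of_hasDerivAt_zero_Ioi hE hx hy
  have hp2 : ∀ x, 0 < x → (g x / u x) ^ 2 = ω + 1 - 2 * Real.log (u x) := by
    intro x hx
    have h0 := hE0 x hx
    have hx0 := (hpos x hx).ne'
    rw [hl] at h0
    field_simp
    linear_combination h0
  -- At zero energy `(u'/u)' = ω - log u² - (u'/u)² = -1`.
  have hp : ∀ x, 0 < x → HasDerivAt (fun x => g x / u x + x) 0 x := by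
    intro x hx
    have hx0 := (hpos x hx).ne'
    have h1 := ((hg x hx).div (hu x hx) hx0).add (hasDerivAt_id x)
    convert! h1 using 1
    have h2 := hE0 x hx
    field_simp
    linear_combination h2
  -- The centre `b` is the constant value of `u'/u + x`, read off at `x = 1`; inserting `u'/u = b -
  -- x` into `hp2` gives `log u`.
  refine ⟨g 1 / u 1 + 1, fun x hx => ?_⟩
  have h1 := eq_of_hasDerivAt_zero_Ioi hp hx one_pos
  have h2 := hp2 x hx
  rw [← h1]
  linear_combination (1 / 2) * h2

theorem continuousOn_logNonlin {f : ℝ → ℂ} (hc : ContinuousOn f (Ici 0))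
    (hpos : ∀ x, 0 ≤ x → 0 < (f x).re ∧ (f x).im = 0) :
    ContinuousOn (fun x => logNonlin (f x)) (Ici 0) := by
  refine hc.mul (Complex.continuous_ofReal.comp_continuousOn ((hc.norm.pow 2).log fun x hx => ?_))
  have : f x ≠ 0 := fun h => by simpa [h] using (hpos x hx).1
  exact pow_ne_zero 2 (norm_ne_zero_iff.2 this)

end StarGraph

namespace StarGraph

open Filter Topology

/-! ### Testing the equation edge by edge. -/

theorem memL2_ofReal_of_hasCompactSupport {ξ : ℝ → ℝ} (hξ : Continuous ξ)
    (hc : HasCompactSupport ξ) : MemL2 (fun x => (ξ x : ℂ)) :=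
  ((hξ.memLp_of_hasCompactSupport hc).restrict _).ofReal

theorem isWeakDeriv_ofReal {ξ : ℝ → ℝ} (hξ : ContDiff ℝ (⊤ : ℕ∞) ξ) :
    IsWeakDeriv (fun x => (ξ x : ℂ)) (fun x => ((deriv ξ x : ℝ) : ℂ)) :=
  isWeakDeriv_of_hasDerivAt
    (fun x => ((hξ.differentiable (by simp) x).hasDerivAt).ofReal_comp)
    (Complex.continuous_ofReal.comp (hξ.continuous_deriv (by simp)))

/-- All components vanish at the vertex, so test functions on different edges can be chosen
independently. -/
theorem memW_ofReal_of_test {N : ℕ} {ζ : Fin N → ℝ → ℝ} (hζ : ∀ r, ContDiff ℝ (⊤ : ℕ∞) (ζ r))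
    (hc : ∀ r, HasCompactSupport (ζ r)) (hs : ∀ r, tsupport (ζ r) ⊆ Ioi 0) :
    MemW (fun r x => (ζ r x : ℂ)) where
  memH1 r := ⟨memL2_ofReal_of_hasCompactSupport (hζ r).continuous (hc r), _,
    memL2_ofReal_of_hasCompactSupport ((hζ r).continuous_deriv (by simp)) (hc r).deriv,
    isWeakDeriv_ofReal (hζ r)⟩
  continuousOn r := (Complex.continuous_ofReal.comp (hζ r).continuous).continuousOn
  vertex e r := by
    rw [image_eq_zero_of_notMem_tsupport fun h => lt_irrefl (0 : ℝ) (hs e h),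
      image_eq_zero_of_notMem_tsupport fun h => lt_irrefl (0 : ℝ) (hs r h)]
  integrable_log r := by
    have h1 : Continuous fun x => ζ r x ^ 2 * Real.log (ζ r x ^ 2) :=
      -- `t log t` is continuous at zero with the convention `Real.log 0 = 0`.
      Real.continuous_mul_log.comp ((hζ r).continuous.pow 2)
    have h2 : HasCompactSupport fun x => ζ r x ^ 2 * Real.log (ζ r x ^ 2) :=
      (hc r).comp_left (g := fun y => y ^ 2 * Real.log (y ^ 2)) (by simp)
    simpa using (h1.integrable_of_hasCompactSupport h2).integrableOn (s := Ioi 0)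

theorem stationaryPairing_test {N : ℕ} (γ ω : ℝ) (φ : Fin N → ℝ → ℂ) {ζ : Fin N → ℝ → ℝ}
    (hζ : ∀ r, ContDiff ℝ (⊤ : ℕ∞) (ζ r))
    (hc : ∀ r, HasCompactSupport (ζ r)) (hs : ∀ r, tsupport (ζ r) ⊆ Ioi 0) :
    stationaryPairing γ ω φ (fun r x => (ζ r x : ℂ)) =
      ∑ r, ((∫ x in Ioi (0 : ℝ), deriv (ζ r) x • weakDeriv (φ r) x)
        + ω * (∫ x in Ioi (0 : ℝ), ζ r x • φ r x)
        - ∫ x in Ioi (0 : ℝ), ζ r x • logNonlin (φ r x)) := by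
  have hv : vertexValue (fun r x => (ζ r x : ℂ)) = 0 := by
    unfold vertexValue
    split_ifs
    · simp only
      rw [image_eq_zero_of_notMem_tsupport fun h => lt_irrefl (0 : ℝ) (hs _ h), Complex.ofReal_zero]
    · rfl
  rw [stationaryPairing_eq_sum, hv, map_zero, mul_zero, mul_zero, sub_zero]
  refine Finset.sum_congr rfl fun r _ => ?_
  have h1 : ∫ x in Ioi (0 : ℝ), weakDeriv (φ r) x * conj (weakDeriv (fun x => (ζ r x : ℂ)) x)
      = ∫ x in Ioi (0 : ℝ), deriv (ζ r) x • weakDeriv (φ r) x := by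
    refine integral_congr_ae ((weakDeriv_ae_eq
      (memL2_ofReal_of_hasCompactSupport ((hζ r).continuous_deriv (by simp)) (hc r).deriv)
      (isWeakDeriv_ofReal (hζ r))
      (memL2_ofReal_of_hasCompactSupport (hζ r).continuous (hc r))).mono fun x hx => ?_)
    simp only [hx, Complex.conj_ofReal, Complex.real_smul, mul_comm]
  rw [h1]
  simp only [Complex.conj_ofReal, Complex.real_smul, mul_comm]

/-- On each edge a solution satisfies `φ'' = ω φ - φ Log |φ|²` weakly. -/
theorem IsStationarySolution.isWeakDeriv_weakDeriv {N : ℕ} {γ ω : ℝ} {φ : Fin N → ℝ → ℂ}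
    (h : IsStationarySolution γ ω φ) (e : Fin N) :
    IsWeakDeriv (weakDeriv (φ e)) (fun x => ω * φ e x - logNonlin (φ e x)) := by
  intro ξ hξ hξc hξs
  -- Extending `ξ` by zero to the other edges isolates the equation on edge `e`.
  let ζ : Fin N → ℝ → ℝ := Pi.single e ξ
  have hζe : ζ e = ξ := Pi.single_eq_same (M := fun _ => ℝ → ℝ) e ξ
  have hζ0 : ∀ r, r ≠ e → ζ r = 0 := fun r hr =>
    Pi.single_eq_of_ne (M := fun _ => ℝ → ℝ) hr ξ
  have hcases : ∀ {P : (ℝ → ℝ) → Prop}, P ξ → P 0 → ∀ r, P (ζ r) := fun h1 h0 r => by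
    by_cases hr : r = e
    · rwa [hr, hζe]
    · rwa [hζ0 r hr]
  have hζ : ∀ r, ContDiff ℝ (⊤ : ℕ∞) (ζ r) := hcases (P := ContDiff ℝ (⊤ : ℕ∞)) hξ contDiff_const
  have hζc : ∀ r, HasCompactSupport (ζ r) := hcases hξc HasCompactSupport.zero
  have hζs : ∀ r, tsupport (ζ r) ⊆ Ioi 0 :=
    hcases (P := fun η => tsupport η ⊆ Ioi 0) hξs (by simp [tsupport])
  have hW := memW_ofReal_of_test hζ hζc hζs
  have h0 := h.2 _ hW
  rw [stationaryPairing_test γ ω φ hζ hζc hζs, Finset.sum_eq_single e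
    (fun r _ hr => by rw [hζ0 r hr]; simp) (by simp), hζe] at h0
  have i1 : IntegrableOn (fun x => ξ x • (ω * φ e x)) (Ioi 0) := by
    refine (((h.1.memH1 e).1.integrable_mul_conj (hW.memH1 e).1).const_mul (ω : ℂ)).congr
      (Eventually.of_forall fun x => ?_)
    simp only [hζe, Complex.conj_ofReal, Complex.real_smul]
    ring
  have i2 : IntegrableOn (fun x => ξ x • logNonlin (φ e x)) (Ioi 0) := by
    refine (h.1.integrable_logNonlin hW e).congr (Eventually.of_forall fun x => ?_)
    simp only [hζe, Complex.conj_ofReal, Complex.real_smul]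
    ring
  simp only [smul_sub]
  rw [integral_sub i1 i2]
  simp only [← mul_smul_comm]
  rw [integral_const_mul]
  linear_combination h0

theorem IsStationarySolution.exists_eq_gausson {N : ℕ} {γ ω : ℝ} {φ : Fin N → ℝ → ℂ}
    (h : IsStationarySolution γ ω φ) (hp : IsPositive φ) (e : Fin N) :
    ∃ b : ℝ, ∀ x, 0 ≤ x → φ e x = gausson ω b x := by
  have hc := h.1.continuousOn e
  have hH := h.1.memH1 e
  have hre : ∀ x, 0 ≤ x → φ e x = ((φ e x).re : ℂ) := fun x hx =>
    Complex.ext (by simp) (by simpa using (hp e x hx).2)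
  have hn : ∀ x, 0 ≤ x → ‖φ e x‖ = (φ e x).re := fun x hx => by
    rw [hre x hx, Complex.norm_real, Real.norm_of_nonneg (by simpa using (hp e x hx).1.le)]
    simp
  obtain ⟨g, hg, hd⟩ := exists_hasDerivAt_of_isWeakDeriv_weakDeriv hH hc
    ((continuousOn_const.mul hc).sub (continuousOn_logNonlin hc (hp e))) (h.isWeakDeriv_weakDeriv e)
  obtain ⟨b, hb⟩ := exists_log_eq_of_hasDerivAt (ω := ω) (u := fun x => (φ e x).re)
    (g := fun x => (g x).re)
    (fun x hx => (hp e x hx.le).1)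
    (fun x hx => Complex.reCLM.hasFDerivAt.comp_hasDerivAt x (hd x hx).1)
    (fun x hx => by
      convert! Complex.reCLM.hasFDerivAt.comp_hasDerivAt x (hd x hx).2 using 1
      simp [logNonlin, ← hn x hx.le])
    ((memLp_two_iff_integrable_sq hH.1.re.1).1 hH.1.re)
    ((memLp_two_iff_integrable_sq hg.re.1).1 hg.re)
    ((h.1.integrable_log e).congr_fun (fun x hx => by
      simp only
      rw [hn x (le_of_lt hx)]) measurableSet_Ioi)
  -- The differential equation gives the formula for `x > 0` only; continuity carries it to the
  -- vertex.
  refine ⟨b, eqOn_Ici_of_ae_eq hc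
    (Complex.continuous_ofReal.comp (contDiff_gausson ω b).continuous).continuousOn
    ((ae_restrict_iff' measurableSet_Ioi).2 (Eventually.of_forall fun x hx => ?_))⟩
  have hx : 0 < x := hx
  rw [hre x hx.le]
  congr 1
  rw [← Real.exp_log (hp e x hx.le).1, hb x hx, gausson, ← Real.exp_add]
  congr 1
  ring

/-! ### Counting signs and permuting edges. -/

theorem profile_eq_gausson (N : ℕ) (γ ω : ℝ) (κ : ℕ) (e : Fin N) (x : ℝ) :
    profile N γ ω κ e x
      = gausson ω (if (e : ℕ) < κ then γ / (N - 2 * κ) else -(γ / (N - 2 * κ))) x := by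
  unfold profile gausson
  split_ifs <;> simp

theorem sum_ite_neg {ι : Type*} [Fintype ι] (p : ι → Prop) [DecidablePred p] (h : ℝ) :
    ∑ i, (if p i then h else -h) = (2 * Fintype.card {i // p i} - Fintype.card ι) * h := by
  have : ∀ i, (if p i then h else -h) = 2 * h * (if p i then 1 else 0) - h := fun i => by
    split_ifs <;> ring
  simp only [this, Finset.sum_sub_distrib, ← Finset.mul_sum, Finset.sum_boole, Finset.sum_const,
    Finset.card_univ, nsmul_eq_mul, Fintype.card_subtype]
  ring

theorem card_fin_val_lt {N κ : ℕ} (h : κ ≤ N) : Fintype.card {i : Fin N // (i : ℕ) < κ} = κ := by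
  rw [Fintype.card_subtype, Fin.card_filter_val_lt, min_eq_right h]

/-- A bijection from the set where `p` holds to the initial segment of the same size extends to a
permutation; it moves the edges with interior maximum to the front. -/
theorem exists_perm_iff_val_lt {N : ℕ} (p : Fin N → Prop) [DecidablePred p] :
    ∃ σ : Equiv.Perm (Fin N), ∀ e, ((σ e : ℕ) < Fintype.card {e // p e} ↔ p e) := by
  have hle : Fintype.card {e // p e} ≤ N := by
    simpa using Fintype.card_subtype_le p
  let τ : {e // p e} ≃ {i : Fin N // (i : ℕ) < Fintype.card {e // p e}} :=
    Fintype.equivOfCardEq (card_fin_val_lt hle).symm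
  refine ⟨τ.extendSubtype, fun e => ⟨fun h => ?_, τ.extendSubtype_mem e⟩⟩
  by_contra hn
  exact τ.extendSubtype_not_mem e hn h

theorem isStationarySolution_and_isPositive_iff {N : ℕ} (hN : 0 < N) {γ ω : ℝ} (hγ : 0 < γ)
    (φ : Fin N → ℝ → ℂ) :
    (IsStationarySolution γ ω φ ∧ IsPositive φ) ↔
      ∃ κ : ℕ, κ ≤ (N - 1) / 2 ∧ ∃ σ : Equiv.Perm (Fin N),
        ∀ e : Fin N, ∀ x : ℝ, 0 ≤ x → φ e x = (profile N γ ω κ (σ e) x : ℂ) := by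
  constructor
  · rintro ⟨hs, hp⟩
    choose b hb using fun e => hs.exists_eq_gausson hp e
    set h := |b ⟨0, hN⟩| with hh
    have hsq : ∀ e, b e ^ 2 = h ^ 2 := fun e => by
      have h1 := hs.1.vertex e ⟨0, hN⟩
      rw [hb e 0 le_rfl, hb _ 0 le_rfl, Complex.ofReal_inj] at h1
      have h2 := congrArg (fun y => Real.log (y ^ 2)) h1
      simp only [log_gausson_sq] at h2
      rw [hh, sq_abs]
      linarith
    have hsum := (isStationarySolution_gausson_iff hN γ hsq hb).1 hs
    -- The strict sign test loses nothing: if `h = 0` both branches agree.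
    have hbe : ∀ e, b e = if 0 < b e then h else -h := fun e => by
      have h0 : 0 ≤ h := abs_nonneg _
      rcases sq_eq_sq_iff_eq_or_eq_neg.1 (hsq e) with h1 | h1
      · split_ifs with h2
        · exact h1
        · linarith
      · rw [if_neg (by linarith), h1]
    rw [Finset.sum_congr rfl fun e _ => hbe e, sum_ite_neg, Fintype.card_fin] at hsum
    obtain ⟨σ, hσ⟩ := exists_perm_iff_val_lt fun e => 0 < b e
    set κ := Fintype.card {e // 0 < b e} with hκ
    -- Otherwise `(2κ - N) h` would be nonnegative, whereas it equals `-γ < 0`.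
    have hlt : 2 * κ < N := by
      by_contra hn
      have h1 : (N : ℝ) ≤ 2 * κ := by exact_mod_cast not_lt.1 hn
      have h2 : 0 ≤ (2 * (κ : ℝ) - N) * h := mul_nonneg (by linarith) (abs_nonneg _)
      linarith
    have hpos : (0 : ℝ) < N - 2 * κ := by
      have : (2 * κ : ℝ) < N := by exact_mod_cast hlt
      linarith
    have hh' : γ / (N - 2 * κ) = h := by
      rw [div_eq_iff hpos.ne']
      linarith
    refine ⟨κ, by omega, σ, fun e x hx => ?_⟩
    rw [hb e x hx, profile_eq_gausson, hh', Complex.ofReal_inj]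
    conv_lhs => rw [hbe e]
    simp only [hσ]
  · rintro ⟨κ, hκ, σ, hφ⟩
    simp only [profile_eq_gausson] at hφ
    refine ⟨(isStationarySolution_gausson_iff (h := γ / (N - 2 * κ)) hN γ (fun e => ?_) hφ).2 ?_,
      fun e x hx => ?_⟩
    · split_ifs <;> ring
    · have hlt : (2 * κ : ℝ) < N := by exact_mod_cast (by omega : 2 * κ < N)
      rw [Equiv.sum_comp σ fun i : Fin N =>
        if (i : ℕ) < κ then γ / (N - 2 * κ : ℝ) else -(γ / (N - 2 * κ)), sum_ite_neg,
        card_fin_val_lt (by omega), Fintype.card_fin]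
      field_simp [(by linarith : (N : ℝ) - 2 * κ ≠ 0)]
      ring
    · rw [hφ e x hx]
      exact ⟨by simpa using gausson_pos _ _ _, Complex.ofReal_im _⟩

/-- The vertex value is the same on every edge, so the permutation plays no role there; its
logarithm gives `h_κ²`, and the positive number `h_κ = γ / (N - 2κ)` determines `κ`. -/
theorem eq_of_profile_perm_eq {N : ℕ} (hN : 0 < N) {γ ω : ℝ} (hγ : 0 < γ) {κ₁ κ₂ : ℕ}
    (h₁ : κ₁ ≤ (N - 1) / 2) (h₂ : κ₂ ≤ (N - 1) / 2) (σ : Equiv.Perm (Fin N))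
    (h : ∀ e : Fin N, ∀ x : ℝ, 0 ≤ x → profile N γ ω κ₁ (σ e) x = profile N γ ω κ₂ e x) :
    κ₁ = κ₂ := by
  have hpos : ∀ κ : ℕ, κ ≤ (N - 1) / 2 → (0 : ℝ) < N - 2 * κ := fun κ hκ => by
    have : (2 * κ : ℝ) < N := by exact_mod_cast (by omega : 2 * κ < N)
    linarith
  have hv : ∀ (κ : ℕ) (e : Fin N), Real.log (profile N γ ω κ e 0 ^ 2)
      = ω + 1 - (γ / (N - 2 * κ)) ^ 2 := fun κ e => by
    rw [profile_eq_gausson, log_gausson_sq]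
    split_ifs <;> ring
  have h0 := congrArg (fun y => Real.log (y ^ 2)) (h ⟨0, hN⟩ 0 le_rfl)
  simp only [hv] at h0
  have p₁ := hpos κ₁ h₁
  have p₂ := hpos κ₂ h₂
  have h3 : γ / (N - 2 * κ₁ : ℝ) = γ / (N - 2 * κ₂) :=
    (pow_left_inj₀ (by positivity) (by positivity) two_ne_zero).1 (by linarith)
  rw [div_eq_div_iff p₁.ne' p₂.ne'] at h3
  have h4 := mul_left_cancel₀ hγ.ne' h3
  exact_mod_cast (by linarith : (κ₁ : ℝ) = κ₂)

end StarGraph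

theorem theorem1p2 (N : ℕ) (hN : 2 ≤ N) (γ ω : ℝ) (hγ : 0 < γ) :
    (∀ φ : Fin N → ℝ → ℂ,
      (StarGraph.IsStationarySolution γ ω φ ∧ StarGraph.IsPositive φ) ↔
        ∃ κ : ℕ, κ ≤ (N - 1) / 2 ∧ ∃ σ : Equiv.Perm (Fin N),
          ∀ e : Fin N, ∀ x : ℝ, 0 ≤ x → φ e x = (StarGraph.profile N γ ω κ (σ e) x : ℂ)) ∧
    (∀ κ₁ κ₂ : ℕ, κ₁ ≤ (N - 1) / 2 → κ₂ ≤ (N - 1) / 2 →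
      (∃ σ : Equiv.Perm (Fin N), ∀ e : Fin N, ∀ x : ℝ, 0 ≤ x →
        StarGraph.profile N γ ω κ₁ (σ e) x = StarGraph.profile N γ ω κ₂ e x) → κ₁ = κ₂) :=
  ⟨StarGraph.isStationarySolution_and_isPositive_iff (by omega) hγ,
    fun _ _ h₁ h₂ ⟨σ, h⟩ => StarGraph.eq_of_profile_perm_eq (by omega) hγ h₁ h₂ σ h⟩
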